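/- \textbf{Setting.} Fix $d,T\in\mathbb N$ and a family $\mathcal A$ of subsets of the arm set $[d]$ (the available actions; for the ordinary bandit problem, the singletons). On a probability space let $(\ell_t)_{t=1}^T$ be a random loss sequence with values in $[0,1]^d$, with an arbitrary law (no independence over rounds or arms). In each round $t$ a player plays a random set of arms $a_t\subseteq[d]$ and pays and observes $\ell_t(j)$ for every $j\in a_t$. Let $\mathcal H_t$ be the $\sigma$-algebra generated by $a_s$ and $\ell_s\odot a_s=(\ell_s(j)1_{j\in a_s})_{j\in[d]}$ for $s<t$, and write $\mathbb P_t=\mathbb P[\,\cdot\mid\mathcal H_t]$; thus the player's beliefs are formed from the true law of the losses (an accurate prior). The player may randomize but sees nothing else of the losses: given $\mathcal H_t$, the set $a_t$ is conditionally independent of the whole sequence $(\ell_1,\dots,\ell_T)$. The total loss of an action $A\in\mathcal A$ is $\sum_{t=1}^T\sum_{j\in A}\ell_t(j)$. Assume that for some constant $\underline L^*>0$ there is almost surely an action of total loss at most $\underline L^*$. Call an action optimal if its total loss is minimal over $\mathcal A$, and let $a^*$ be a random set of arms such that almost surely every $j\in a^*$ belongs to an optimal action (for example, an optimal action with ties broken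 in any way, or the set of all arms of optimal actions). Put \[p_t(j)=\mathbb P_t[j\in a^*],\qquad \hat p_t(j)=\mathbb P_t[j\in a_t].\] \textbf{Theorem.} Suppose that there are constants $\frac1{\underline L^*}\le\gamma_1\le\gamma_2$ and, for every round $t$, an $\mathcal H_t$-measurable partition $[d]=\mathcal R_t\sqcup\mathcal C_t$ of the arms into rare and common arms such that, almost surely, for all $t$ and $j$: \begin{enumerate} \item if $j\in\mathcal C_t$, then $\hat p_t(j)\ge\gamma_1$ and $p_t(j)\ge\gamma_1$; \item if $j\in\mathcal R_t$, then $\hat p_t(j)\le p_t(j)\le\gamma_2$. \end{enumerate} Then for every arm $i$: \begin{enumerate} \item[(A)] $\displaystyle \mathbb E\Big[\sum_{t:\,i\in\mathcal R_t}\hat p_t(i)\,\ell_t(i)\Big]\le 2\gamma_2\underline L^*+8\log T+4$ (with the convention $\log 0=0$ in the trivial case $T=0$); \item[(B)] if $\gamma_1\le 1$ (which is automatic unless almost surely no arm is ever common), then \[\mathbb E\Big[\sum_{t:\,i\in\mathcal C_t}\ell_t(i)\Big]\le \underline L^*+2\Big(\log\frac1{\gamma_1}+10\Big)\sqrt{\frac{\underline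 L^*}{\gamma_1}}.\] \end{enumerate} -/

import Mathlib

open MeasureTheory ProbabilityTheory

namespace BayesianGame

variable {Ω : Type*} {d T : ℕ}

/-- Information of the player at the beginning of round `t`: the σ-algebra generated by the
past plays `a s` and the past feedback `ℓ s ⊙ a s` (the losses of the arms played in round `s`,
with `0` in the other coordinates), `s < t`.
Subsets of the arm set `Fin d` carry the σ-algebra of `Fin d → Prop`. -/
@[reducible] noncomputable def history (ℓ : Fin T → Ω → Fin d → ℝ) (a : Fin T → Ω → Set (Fin d)) (t : Fin T) :
    MeasurableSpace Ω :=
  ⨆ s : Fin T, ⨆ _ : s < t,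
    MeasurableSpace.comap (fun ω => (a s ω, (a s ω).indicator (ℓ s ω))) inferInstance

/-- The σ-algebra generated by the whole loss sequence. -/
@[reducible] def lossSigma (ℓ : Fin T → Ω → Fin d → ℝ) : MeasurableSpace Ω :=
  MeasurableSpace.comap (fun ω t => ℓ t ω) inferInstance

/-- In every round the played set is drawn from a distribution that depends on the player's
information only: given the player's history, the law of `a t` does not change when the whole
loss sequence is revealed in addition. -/
def IsNonanticipating [MeasurableSpace Ω] (μ : Measure Ω)
    (ℓ : Fin T → Ω → Fin d → ℝ) (a : Fin T → Ω → Set (Fin d)) : Prop :=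
  ∀ (t : Fin T) (A : Set (Fin d)),
    μ⟦{ω | a t ω = A} | history ℓ a t ⊔ lossSigma ℓ⟧ =ᵐ[μ] μ⟦{ω | a t ω = A} | history ℓ a t⟧

/-- Total loss `∑ t, ⟨ℓ t, A⟩` of the action (set of arms) `A` along the loss sequence `l`. -/
noncomputable def totalLoss (l : Fin T → Fin d → ℝ) (A : Set (Fin d)) : ℝ :=
  ∑ t, ∑ i, A.indicator (l t) i

/-- `A` is an optimal action in hindsight among the available actions `𝒜`. -/
def IsOptimalAction (𝒜 : Set (Set (Fin d))) (l : Fin T → Fin d → ℝ) (A : Set (Fin d)) : Prop :=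
  A ∈ 𝒜 ∧ ∀ B ∈ 𝒜, totalLoss l A ≤ totalLoss l B

/-- `p t i`: the probability, given the history at the beginning of round `t`, that `i`
belongs to the optimal set `astar`. -/
noncomputable def optProb [MeasurableSpace Ω] (μ : Measure Ω)
    (ℓ : Fin T → Ω → Fin d → ℝ) (a : Fin T → Ω → Set (Fin d)) (astar : Ω → Set (Fin d))
    (t : Fin T) (i : Fin d) : Ω → ℝ :=
  μ⟦{ω | i ∈ astar ω} | history ℓ a t⟧

/-- `p̂ t i`: the probability, given the history at the beginning of round `t`, that arm `i`
is played in round `t`. -/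
noncomputable def playProb [MeasurableSpace Ω] (μ : Measure Ω)
    (ℓ : Fin T → Ω → Fin d → ℝ) (a : Fin T → Ω → Set (Fin d))
    (t : Fin T) (i : Fin d) : Ω → ℝ :=
  μ⟦{ω | i ∈ a t ω} | history ℓ a t⟧

open Classical in
/-- The rounds in which arm `i` is rare, where `R t` is the set of rare arms in round `t`. -/
noncomputable def rareRounds (R : Fin T → Ω → Set (Fin d)) (i : Fin d) (ω : Ω) :
    Finset (Fin T) :=
  {t | i ∈ R t ω}

open Classical in
/-- The rounds in which arm `i` is common, the common arms being those that are not rare. -/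
noncomputable def commonRounds (R : Fin T → Ω → Set (Fin d)) (i : Fin d) (ω : Ω) :
    Finset (Fin T) :=
  {t | i ∉ R t ω}

end BayesianGame

namespace BayesianGame

/-! Fix an arm. Write `b` for the indicator that it lies in the optimal set. Where `b ≠ 0`, its loss
over all rounds is at most that of an optimal action, hence at most `Lstar`. The play is
conditionally independent of the losses, so the whole loss sequence can be revealed in advance:
given it and the history, the arm is still played with probability `q n`. So if `M` is the loss
observed on the arm, with past-measurable weights `v ≥ 0` satisfying `q * (exp v - 1) ≤ c`, then
`exp (M - c * ∑ l)` is a supermartingale, even restricted to an event of the losses. This gives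
`E[exp M * b] ≤ exp (c * Lstar)`: observed loss is small on the event that the arm is optimal
(`integral_exp_observedLoss_mul_le`). The two bounds transfer this to the whole space.

Rare rounds: with weight the indicator of a rare round, the expectation sought is that of `M`. Past
a level `s`, a further increment costs at most the play probability, which is dominated by the
conditional probability of `b`; it is thus paid for by the exponential moment on `b`, discounted by
`exp (-s)`. Taking `s = 2 * γ₂ * Lstar + log T` makes each round cost `1 / T`.

Common rounds: weighting by `t / q` makes `M` an unbiased estimate of `t` times the loss in common
rounds. Whenever `M` can move, `b` has conditional probability at least `γ₁`, so the exponential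
moment of `M` just before its last possible move is at most about `γ₁⁻¹` times that on `b`
(`integral_exp_lastValue_le`). Jensen's inequality and the choice of `t` finish the bound. -/

/-- Integrating against a bounded `m`-measurable weight does not see the difference between a
function and its conditional expectation. -/
theorem integral_mul_eq_of_condExp_ae_eq {Ω : Type*} {m m0 : MeasurableSpace Ω} {μ : Measure Ω}
    [IsProbabilityMeasure μ] (hm : m ≤ m0) {Q f g : Ω → ℝ} (hQ : Measurable[m] Q) {C : ℝ}
    (hC : ∀ ω, |Q ω| ≤ C) (hf : Integrable f μ) (hg : μ[f | m] =ᵐ[μ] g) :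
    ∫ ω, Q ω * f ω ∂μ = ∫ ω, Q ω * g ω ∂μ := by
  have hQf : Integrable (Q * f) μ :=
    hf.bdd_mul (hQ.mono hm le_rfl).aestronglyMeasurable
      (Filter.Eventually.of_forall fun ω => by simpa using hC ω)
  have h1 := condExp_mul_of_stronglyMeasurable_left hQ.stronglyMeasurable hQf hf
  calc ∫ ω, Q ω * f ω ∂μ = ∫ ω, (μ[Q * f | m]) ω ∂μ := (integral_condExp hm).symm
    _ = ∫ ω, Q ω * g ω ∂μ := by
      refine integral_congr_ae ?_
      filter_upwards [h1, hg] with ω h h'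
      simp [h, h']

theorem integrable_of_measurable_of_abs_le {Ω : Type*} {m m0 : MeasurableSpace Ω} {μ : Measure Ω}
    [IsProbabilityMeasure μ] (hm : m ≤ m0) {Q : Ω → ℝ} (hQ : Measurable[m] Q) {C : ℝ}
    (hC : ∀ ω, |Q ω| ≤ C) : Integrable Q μ :=
  Integrable.of_bound (hQ.mono hm le_rfl).aestronglyMeasurable C
    (Filter.Eventually.of_forall fun ω => by simpa using hC ω)

theorem exp_mul_le_one_add {y v : ℝ} (hy0 : 0 ≤ y) (hy1 : y ≤ 1) :
    Real.exp (v * y) ≤ 1 + y * (Real.exp v - 1) := by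
  have := convexOn_exp.2 (Set.mem_univ (0 : ℝ)) (Set.mem_univ v) (sub_nonneg.2 hy1) hy0
    (by ring)
  simp only [smul_eq_mul, mul_zero, zero_add, Real.exp_zero, mul_one] at this
  rw [mul_comm v y]
  linarith

/-! ### A single arm and its observed loss -/

/-- One arm in a game with an oblivious environment: `H n` is the player's information at the
beginning of round `n`, `L` the information contained in the losses, `x n` the indicator of
playing the arm, `l n` its loss, `q n` the conditional probability of playing it. -/
structure ArmProcess {Ω : Type*} {m0 : MeasurableSpace Ω} (μ : Measure Ω)
    (H : ℕ → MeasurableSpace Ω) (L : MeasurableSpace Ω) (x l q : ℕ → Ω → ℝ) : Prop where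
  H_le : ∀ n, H n ≤ m0
  H_mono : Monotone H
  L_le : L ≤ m0
  x_meas : ∀ n, Measurable[m0] (x n)
  x_nonneg : ∀ n ω, 0 ≤ x n ω
  x_le : ∀ n ω, x n ω ≤ 1
  l_meas : ∀ n, Measurable[L] (l n)
  l_nonneg : ∀ n ω, 0 ≤ l n ω
  l_le : ∀ n ω, l n ω ≤ 1
  xl_meas : ∀ n, Measurable[H (n + 1)] (fun ω => x n ω * l n ω)
  q_meas : ∀ n, Measurable[H n] (q n)
  q_nonneg : ∀ n, ∀ᵐ ω ∂μ, 0 ≤ q n ω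
  condExp_x : ∀ n, μ[x n | H n ⊔ L] =ᵐ[μ] q n

/-- The weighted loss observed before round `n`. -/
noncomputable def observedLoss {Ω : Type*} (v x l : ℕ → Ω → ℝ) (n : ℕ) (ω : Ω) : ℝ :=
  ∑ k ∈ Finset.range n, v k ω * (x k ω * l k ω)

theorem observedLoss_succ {Ω : Type*} (v x l : ℕ → Ω → ℝ) (n : ℕ) (ω : Ω) :
    observedLoss v x l (n + 1) ω = observedLoss v x l n ω + v n ω * (x n ω * l n ω) :=
  Finset.sum_range_succ _ _

namespace ArmProcess

variable {Ω : Type*} {m0 : MeasurableSpace Ω} {μ : Measure Ω}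
  {H : ℕ → MeasurableSpace Ω} {L : MeasurableSpace Ω} {x l q v : ℕ → Ω → ℝ}

theorem sup_le (h : ArmProcess μ H L x l q) (n : ℕ) : H n ⊔ L ≤ m0 :=
  _root_.sup_le (h.H_le n) h.L_le

theorem integrable_q (h : ArmProcess μ H L x l q) (n : ℕ) : Integrable (q n) μ :=
  integrable_condExp.congr (h.condExp_x n)

theorem xl_nonneg (h : ArmProcess μ H L x l q) (n : ℕ) (ω : Ω) : 0 ≤ x n ω * l n ω :=
  mul_nonneg (h.x_nonneg n ω) (h.l_nonneg n ω)

theorem xl_le (h : ArmProcess μ H L x l q) (n : ℕ) (ω : Ω) : x n ω * l n ω ≤ 1 :=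
  mul_le_one₀ (h.x_le n ω) (h.l_nonneg n ω) (h.l_le n ω)

theorem measurable_observedLoss (h : ArmProcess μ H L x l q) (hv : ∀ n, Measurable[H n] (v n))
    (n : ℕ) : Measurable[H n] (observedLoss v x l n) := by
  unfold observedLoss
  refine Finset.measurable_sum _ fun k hk => ?_
  have hk : k + 1 ≤ n := Finset.mem_range.1 hk
  exact ((hv k).mono (h.H_mono (by omega)) le_rfl).mul ((h.xl_meas k).mono (h.H_mono hk) le_rfl)

theorem observedLoss_mono (h : ArmProcess μ H L x l q) (hv0 : ∀ n ω, 0 ≤ v n ω) (ω : Ω) :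
    Monotone fun n => observedLoss v x l n ω :=
  monotone_nat_of_le_succ fun n => by
    rw [observedLoss_succ]
    have := mul_nonneg (hv0 n ω) (h.xl_nonneg n ω)
    linarith

theorem observedLoss_nonneg (h : ArmProcess μ H L x l q) (hv0 : ∀ n ω, 0 ≤ v n ω) (n : ℕ)
    (ω : Ω) : 0 ≤ observedLoss v x l n ω :=
  Finset.sum_nonneg fun k _ => mul_nonneg (hv0 k ω) (h.xl_nonneg k ω)

theorem observedLoss_le (h : ArmProcess μ H L x l q) (hv0 : ∀ n ω, 0 ≤ v n ω) {K : ℝ}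
    (hvK : ∀ n ω, v n ω ≤ K) (n : ℕ) (ω : Ω) : observedLoss v x l n ω ≤ n * K := by
  have : observedLoss v x l n ω ≤ ∑ k ∈ Finset.range n, K :=
    Finset.sum_le_sum fun k _ =>
      (mul_le_of_le_one_right (hv0 k ω) (h.xl_le k ω)).trans (hvK k ω)
  simpa using this

theorem integrable_mul_q (h : ArmProcess μ H L x l q) {n : ℕ} {Q : Ω → ℝ}
    (hQ : Measurable[H n ⊔ L] Q) {C : ℝ} (hC : ∀ ω, |Q ω| ≤ C) :
    Integrable (fun ω => Q ω * q n ω) μ :=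
  (h.integrable_q n).bdd_mul (hQ.mono (h.sup_le n) le_rfl).aestronglyMeasurable
    (Filter.Eventually.of_forall fun ω => by simpa using hC ω)

variable [IsProbabilityMeasure μ]

theorem integrable_x (h : ArmProcess μ H L x l q) (n : ℕ) : Integrable (x n) μ :=
  integrable_of_measurable_of_abs_le (m := m0) le_rfl (h.x_meas n) (C := 1)
    fun ω => by rw [abs_of_nonneg (h.x_nonneg n ω)]; exact h.x_le n ω

theorem integrable_mul_x (h : ArmProcess μ H L x l q) {n : ℕ} {Q : Ω → ℝ}
    (hQ : Measurable[H n ⊔ L] Q) {C : ℝ} (hC : ∀ ω, |Q ω| ≤ C) :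
    Integrable (fun ω => Q ω * x n ω) μ :=
  (h.integrable_x n).bdd_mul (hQ.mono (h.sup_le n) le_rfl).aestronglyMeasurable
    (Filter.Eventually.of_forall fun ω => by simpa using hC ω)

theorem integral_mul_x (h : ArmProcess μ H L x l q) {n : ℕ} {Q : Ω → ℝ}
    (hQ : Measurable[H n ⊔ L] Q) {C : ℝ} (hC : ∀ ω, |Q ω| ≤ C) :
    ∫ ω, Q ω * x n ω ∂μ = ∫ ω, Q ω * q n ω ∂μ :=
  integral_mul_eq_of_condExp_ae_eq (h.sup_le n) hQ hC (h.integrable_x n) (h.condExp_x n)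

/-! ### Exponential moments of the observed loss -/

/-- Supermartingale argument with respect to `H n ⊔ L`: convexity bounds the conditional mean of
`exp (v * x * l)` by `1 + q * l * (exp v - 1) ≤ 1 + c * l ≤ exp (c * l)`, which the compensator
cancels. The factor `B` is measurable from the start because `L` contains all losses. -/
theorem integral_exp_observedLoss_sub_le (h : ArmProcess μ H L x l q)
    (hv : ∀ n, Measurable[H n] (v n)) (hv0 : ∀ n ω, 0 ≤ v n ω) {K : ℝ}
    (hvK : ∀ n ω, v n ω ≤ K) {c : ℝ} (hc0 : 0 ≤ c)
    (hc : ∀ n, ∀ᵐ ω ∂μ, q n ω * (Real.exp (v n ω) - 1) ≤ c) {B : Ω → ℝ}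
    (hB : Measurable[L] B) (hB0 : ∀ ω, 0 ≤ B ω) (hB1 : ∀ ω, B ω ≤ 1) (n : ℕ) :
    ∫ ω, Real.exp (observedLoss v x l n ω - c * ∑ k ∈ Finset.range n, l k ω) * B ω ∂μ ≤ 1 := by
  set D : ℕ → Ω → ℝ := fun n ω =>
    Real.exp (observedLoss v x l n ω - c * ∑ k ∈ Finset.range n, l k ω) * B ω with hD
  have hDmeas : ∀ n, Measurable[H n ⊔ L] (D n) := fun n =>
    (Real.measurable_exp.comp
      (((h.measurable_observedLoss hv n).mono le_sup_left le_rfl).sub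
        ((Finset.measurable_sum _ fun k _ =>
          (h.l_meas k).mono (le_sup_right : L ≤ H n ⊔ L) le_rfl).const_mul c))).mul (hB.mono le_sup_right le_rfl)
  have hD0 : ∀ n ω, 0 ≤ D n ω := fun n ω => mul_nonneg (Real.exp_pos _).le (hB0 ω)
  have hDle : ∀ n ω, D n ω ≤ Real.exp (n * K) := fun n ω => by
    refine (mul_le_of_le_one_right (Real.exp_pos _).le (hB1 ω)).trans (Real.exp_le_exp.2 ?_)
    have h1 := h.observedLoss_le hv0 hvK n ω
    have h2 : 0 ≤ c * ∑ k ∈ Finset.range n, l k ω :=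
      mul_nonneg hc0 (Finset.sum_nonneg fun k _ => h.l_nonneg k ω)
    linarith
  have hDint : ∀ n, Integrable (D n) μ := fun n =>
    integrable_of_measurable_of_abs_le (h.sup_le n) (hDmeas n)
      (fun ω => by rw [abs_of_nonneg (hD0 n ω)]; exact hDle n ω)
  change ∫ ω, D n ω ∂μ ≤ 1
  induction n with
  | zero =>
    calc ∫ ω, D 0 ω ∂μ ≤ ∫ _, (1 : ℝ) ∂μ :=
          integral_mono (hDint 0) (integrable_const _) fun ω => by simpa using hDle 0 ω
      _ = 1 := by simp
  | succ n ih =>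
    refine le_trans ?_ ih
    -- Convexity gives `D (n + 1) ≤ Q₀ + Q * x n`. The right side is affine in `x n` with `H n ⊔
    -- L`-measurable coefficients, so `x n` may be replaced by `q n` under the integral.
    set Q₀ : Ω → ℝ := fun ω => D n ω * Real.exp (-(c * l n ω)) with hQ₀
    set Q : Ω → ℝ := fun ω => Q₀ ω * (l n ω * (Real.exp (v n ω) - 1)) with hQ
    have hl : Measurable[H n ⊔ L] (l n) := (h.l_meas n).mono le_sup_right le_rfl
    have hQ₀meas : Measurable[H n ⊔ L] Q₀ :=
      (hDmeas n).mul (Real.measurable_exp.comp (hl.const_mul c).neg)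
    have hQmeas : Measurable[H n ⊔ L] Q :=
      hQ₀meas.mul (hl.mul ((Real.measurable_exp.comp
        ((hv n).mono le_sup_left le_rfl)).sub_const 1))
    have hQ₀0 : ∀ ω, 0 ≤ Q₀ ω := fun ω => mul_nonneg (hD0 n ω) (Real.exp_pos _).le
    have hQ₀le : ∀ ω, Q₀ ω ≤ Real.exp (n * K) := fun ω =>
      (mul_le_of_le_one_right (hD0 n ω) (Real.exp_le_one_iff.2
        (neg_nonpos.2 (mul_nonneg hc0 (h.l_nonneg n ω))))).trans (hDle n ω)
    have hE0 : ∀ ω, 0 ≤ l n ω * (Real.exp (v n ω) - 1) := fun ω =>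
      mul_nonneg (h.l_nonneg n ω) (sub_nonneg.2 (Real.one_le_exp (hv0 n ω)))
    have hEle : ∀ ω, l n ω * (Real.exp (v n ω) - 1) ≤ Real.exp K := fun ω => by
      have h1 : Real.exp (v n ω) ≤ Real.exp K := Real.exp_le_exp.2 (hvK n ω)
      have h2 : l n ω * (Real.exp (v n ω) - 1) ≤ Real.exp (v n ω) - 1 :=
        mul_le_of_le_one_left (sub_nonneg.2 (Real.one_le_exp (hv0 n ω))) (h.l_le n ω)
      linarith
    have hQbd : ∀ ω, |Q ω| ≤ Real.exp (n * K) * Real.exp K := fun ω => by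
      rw [abs_of_nonneg (mul_nonneg (hQ₀0 ω) (hE0 ω))]
      exact mul_le_mul (hQ₀le ω) (hEle ω) (hE0 ω) (Real.exp_pos _).le
    have hQ₀int : Integrable Q₀ μ :=
      integrable_of_measurable_of_abs_le (h.sup_le n) hQ₀meas
        (fun ω => by rw [abs_of_nonneg (hQ₀0 ω)]; exact hQ₀le ω)
    calc ∫ ω, D (n + 1) ω ∂μ ≤ ∫ ω, (Q₀ ω + Q ω * x n ω) ∂μ := by
          refine integral_mono (hDint _) (hQ₀int.add (h.integrable_mul_x hQmeas hQbd)) fun ω => ?_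
          have h1 : D (n + 1) ω = Q₀ ω * Real.exp (v n ω * (x n ω * l n ω)) := by
            simp only [hQ₀, hD, observedLoss_succ, Finset.sum_range_succ]
            rw [show observedLoss v x l n ω + v n ω * (x n ω * l n ω)
                - c * (∑ k ∈ Finset.range n, l k ω + l n ω)
                = observedLoss v x l n ω - c * ∑ k ∈ Finset.range n, l k ω
                  + -(c * l n ω) + v n ω * (x n ω * l n ω) by ring, Real.exp_add, Real.exp_add]
            ring
          have h2 := mul_le_mul_of_nonneg_left
            (exp_mul_le_one_add (v := v n ω) (h.xl_nonneg n ω) (h.xl_le n ω)) (hQ₀0 ω)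
          rw [h1]
          refine h2.trans (le_of_eq ?_)
          simp only [hQ]
          ring
      _ = ∫ ω, (Q₀ ω + Q ω * q n ω) ∂μ := by
          rw [integral_add hQ₀int (h.integrable_mul_x hQmeas hQbd),
            integral_add hQ₀int (h.integrable_mul_q hQmeas hQbd), h.integral_mul_x hQmeas hQbd]
      _ ≤ ∫ ω, D n ω ∂μ := by
          refine integral_mono_ae (hQ₀int.add (h.integrable_mul_q hQmeas hQbd)) (hDint n) ?_
          filter_upwards [hc n] with ω hω
          have h1 : Q₀ ω + Q ω * q n ω ≤ Q₀ ω * (c * l n ω + 1) := by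
            have := mul_le_mul_of_nonneg_left hω (mul_nonneg (hQ₀0 ω) (h.l_nonneg n ω))
            simp only [hQ]
            linarith
          have h2 : Q₀ ω * (c * l n ω + 1) ≤ Q₀ ω * Real.exp (c * l n ω) :=
            mul_le_mul_of_nonneg_left (Real.add_one_le_exp _) (hQ₀0 ω)
          have h3 : Q₀ ω * Real.exp (c * l n ω) = D n ω := by
            simp only [hQ₀]
            rw [mul_assoc, ← Real.exp_add]
            simp
          linarith

/-- On the event that the arm has small total loss, the observed loss has an exponential moment. -/
theorem integral_exp_observedLoss_mul_le (h : ArmProcess μ H L x l q)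
    (hv : ∀ n, Measurable[H n] (v n)) (hv0 : ∀ n ω, 0 ≤ v n ω) {K : ℝ}
    (hvK : ∀ n ω, v n ω ≤ K) {c : ℝ} (hc0 : 0 ≤ c)
    (hc : ∀ n, ∀ᵐ ω ∂μ, q n ω * (Real.exp (v n ω) - 1) ≤ c) {N : ℕ} {Λ : ℝ} {b : Ω → ℝ}
    (hb : Measurable[m0] b) (hb0 : ∀ ω, 0 ≤ b ω) (hb1 : ∀ ω, b ω ≤ 1)
    (hbΛ : ∀ᵐ ω ∂μ, b ω ≠ 0 → ∑ k ∈ Finset.range N, l k ω ≤ Λ) {n : ℕ} (hn : n ≤ N) :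
    ∫ ω, Real.exp (observedLoss v x l n ω) * b ω ∂μ ≤ Real.exp (c * Λ) := by
  -- `b` need not be a function of the losses (ties may be broken at random), so it is dominated by
  -- the indicator of this event in `L`.
  set S : Set Ω := {ω | ∑ k ∈ Finset.range N, l k ω ≤ Λ} with hS
  have hSm : MeasurableSet[L] S :=
    measurableSet_le (Finset.measurable_sum _ fun k _ => h.l_meas k) measurable_const
  set B : Ω → ℝ := S.indicator 1 with hBdef
  have hB : Measurable[L] B := measurable_one.indicator hSm
  have hB0 : ∀ ω, 0 ≤ B ω := fun ω => Set.indicator_nonneg (fun _ _ => zero_le_one) ω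
  have hB1 : ∀ ω, B ω ≤ 1 := fun ω => by
    by_cases hω : ω ∈ S <;> simp [hBdef, hω]
  have key := h.integral_exp_observedLoss_sub_le hv hv0 hvK hc0 hc hB hB0 hB1 N
  have hMN := h.measurable_observedLoss hv
  have hΛN : Measurable[m0] fun ω => ∑ k ∈ Finset.range N, l k ω :=
    Finset.measurable_sum _ fun k _ => (h.l_meas k).mono h.L_le le_rfl
  have hexp : Integrable (fun ω => Real.exp (observedLoss v x l n ω) * b ω) μ := by
    refine integrable_of_measurable_of_abs_le (m := m0) (C := Real.exp (n * K)) le_rfl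
      ((Real.measurable_exp.comp ((hMN n).mono (h.H_le n) le_rfl)).mul hb) fun ω => ?_
    rw [abs_of_nonneg (mul_nonneg (Real.exp_pos _).le (hb0 ω))]
    exact (mul_le_of_le_one_right (Real.exp_pos _).le (hb1 ω)).trans
      (Real.exp_le_exp.2 (h.observedLoss_le hv0 hvK n ω))
  have hexp' : Integrable (fun ω =>
      Real.exp (observedLoss v x l N ω - c * ∑ k ∈ Finset.range N, l k ω) * B ω) μ := by
    refine integrable_of_measurable_of_abs_le (m := m0) (C := Real.exp (N * K)) le_rfl
      ((Real.measurable_exp.comp (((hMN N).mono (h.H_le N) le_rfl).sub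
        (hΛN.const_mul c))).mul (hB.mono h.L_le le_rfl)) fun ω => ?_
    rw [abs_of_nonneg (mul_nonneg (Real.exp_pos _).le (hB0 ω))]
    refine (mul_le_of_le_one_right (Real.exp_pos _).le (hB1 ω)).trans (Real.exp_le_exp.2 ?_)
    have h1 := h.observedLoss_le hv0 hvK N ω
    have h2 : 0 ≤ c * ∑ k ∈ Finset.range N, l k ω :=
      mul_nonneg hc0 (Finset.sum_nonneg fun k _ => h.l_nonneg k ω)
    linarith
  calc ∫ ω, Real.exp (observedLoss v x l n ω) * b ω ∂μ
      ≤ ∫ ω, Real.exp (c * Λ) *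
          (Real.exp (observedLoss v x l N ω - c * ∑ k ∈ Finset.range N, l k ω) * B ω) ∂μ := by
        refine integral_mono_ae hexp (hexp'.const_mul _) ?_
        filter_upwards [hbΛ] with ω hω
        by_cases hbω : b ω = 0
        · simp only [hbω, mul_zero]
          exact mul_nonneg (Real.exp_pos _).le (mul_nonneg (Real.exp_pos _).le (hB0 ω))
        · have hωS : ω ∈ S := hω hbω
          have hBω : B ω = 1 := by simp [hBdef, hωS]
          simp only [hBω, mul_one]
          rw [← Real.exp_add]
          refine (mul_le_of_le_one_right (Real.exp_pos _).le (hb1 ω)).trans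
            (Real.exp_le_exp.2 ?_)
          have h1 := h.observedLoss_mono hv0 ω hn
          have h2 := mul_le_mul_of_nonneg_left (hω hbω) hc0
          simp only at h1
          linarith
    _ = Real.exp (c * Λ) * _ := integral_const_mul _ _
    _ ≤ Real.exp (c * Λ) := mul_le_of_le_one_right (Real.exp_pos _).le key

/-! ### Rare rounds -/

/-- A sum of increments in `[0,1]` exceeds a level by at most one, up to increments that are
discounted exponentially in the excess. -/
theorem sum_range_le_level_add_exp (u : ℕ → ℝ) (hu0 : ∀ n, 0 ≤ u n) (hu1 : ∀ n, u n ≤ 1)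
    {s : ℝ} (hs : 0 ≤ s) (n : ℕ) :
    ∑ k ∈ Finset.range n, u k ≤
      s + 1 + ∑ k ∈ Finset.range n, Real.exp (∑ j ∈ Finset.range k, u j - s) * u k := by
  induction n with
  | zero => simp; linarith
  | succ n ih =>
    rw [Finset.sum_range_succ, Finset.sum_range_succ _ n]
    -- Above the level the discount factor is at least one, so the new term on the right pays for
    -- the increment; below it, one increment cannot lead past `s + 1`.
    rcases le_total s (∑ k ∈ Finset.range n, u k) with h | h
    · have : 1 ≤ Real.exp (∑ j ∈ Finset.range n, u j - s) := Real.one_le_exp (sub_nonneg.2 h)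
      have := le_mul_of_one_le_left (hu0 n) this
      linarith
    · have h1 : 0 ≤ ∑ k ∈ Finset.range n, Real.exp (∑ j ∈ Finset.range k, u j - s) * u k :=
        Finset.sum_nonneg fun k _ => mul_nonneg (Real.exp_pos _).le (hu0 k)
      have h2 := mul_nonneg (Real.exp_pos (∑ j ∈ Finset.range n, u j - s)).le (hu0 n)
      linarith [hu1 n]

/-- The level `s` is chosen so that the discount `exp (-s)` turns the moment bound `exp (2 * γ * Λ)`
into `1 / N`; the `N` discounted increments then add up to at most one. -/
theorem integral_sum_rare_le (h : ArmProcess μ H L x l q) {r : ℕ → Ω → ℝ}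
    (hr : ∀ n, Measurable[H n] (r n)) (hr0 : ∀ n ω, 0 ≤ r n ω) (hr1 : ∀ n ω, r n ω ≤ 1)
    {γ Λ : ℝ} (hγ : 0 ≤ γ) (hΛ : 0 ≤ Λ) {N : ℕ} {b : Ω → ℝ} (hb : Measurable[m0] b)
    (hb0 : ∀ ω, 0 ≤ b ω) (hb1 : ∀ ω, b ω ≤ 1)
    (hbΛ : ∀ᵐ ω ∂μ, b ω ≠ 0 → ∑ k ∈ Finset.range N, l k ω ≤ Λ)
    (hrp : ∀ n < N, ∀ᵐ ω ∂μ, r n ω * q n ω ≤ (μ[b | H n]) ω)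
    (hrγ : ∀ n, ∀ᵐ ω ∂μ, r n ω * q n ω ≤ γ) :
    ∫ ω, ∑ n ∈ Finset.range N, r n ω * (q n ω * l n ω) ∂μ ≤ 2 * γ * Λ + Real.log N + 2 := by
  rcases Nat.eq_zero_or_pos N with rfl | hN
  · have := mul_nonneg hγ hΛ
    simp only [Finset.range_zero, Finset.sum_empty, integral_zero, Nat.cast_zero, Real.log_zero]
    linarith
  have hN1 : (1 : ℝ) ≤ N := by exact_mod_cast hN
  set s : ℝ := 2 * γ * Λ + Real.log N with hs
  have hs0 : 0 ≤ s := by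
    have := mul_nonneg hγ hΛ
    have := Real.log_nonneg hN1
    simp only [hs]; linarith
  have hbint : Integrable b μ :=
    integrable_of_measurable_of_abs_le (m := m0) le_rfl hb (C := 1)
      fun ω => by rw [abs_of_nonneg (hb0 ω)]; exact hb1 ω
  have hl : ∀ n, Measurable[H n ⊔ L] (l n) := fun n => (h.l_meas n).mono le_sup_right le_rfl
  have hrl : ∀ n, Measurable[H n ⊔ L] (fun ω => r n ω * l n ω) := fun n =>
    ((hr n).mono le_sup_left le_rfl).mul (hl n)
  have hrl0 : ∀ n ω, 0 ≤ r n ω * l n ω := fun n ω => mul_nonneg (hr0 n ω) (h.l_nonneg n ω)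
  have hrl1 : ∀ n ω, r n ω * l n ω ≤ 1 := fun n ω =>
    mul_le_one₀ (hr1 n ω) (h.l_nonneg n ω) (h.l_le n ω)
  have hrlb : ∀ n ω, |r n ω * l n ω| ≤ 1 := fun n ω => by
    rw [abs_of_nonneg (hrl0 n ω)]; exact hrl1 n ω
  set e : ℕ → Ω → ℝ := fun n ω => Real.exp (observedLoss r x l n ω - s) with he
  have hem : ∀ n, Measurable[H n] (e n) := fun n =>
    Real.measurable_exp.comp ((h.measurable_observedLoss hr n).sub_const s)
  have he0 : ∀ n ω, 0 ≤ e n ω := fun n ω => (Real.exp_pos _).le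
  have heb : ∀ n ω, |e n ω| ≤ Real.exp (n * 1) := fun n ω => by
    rw [abs_of_nonneg (he0 n ω)]
    refine Real.exp_le_exp.2 ?_
    have := h.observedLoss_le hr0 hr1 n ω
    linarith
  have hQm : ∀ n, Measurable[H n ⊔ L] (fun ω => e n ω * (r n ω * l n ω)) := fun n =>
    ((hem n).mono le_sup_left le_rfl).mul (hrl n)
  have hQb : ∀ n ω, |e n ω * (r n ω * l n ω)| ≤ Real.exp (n * 1) * 1 := fun n ω => by
    rw [abs_mul]
    exact mul_le_mul (heb n ω) (hrlb n ω) (abs_nonneg _) (Real.exp_pos _).le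
  have hrate : ∀ n, ∀ᵐ ω ∂μ, q n ω * (Real.exp (r n ω) - 1) ≤ 2 * γ := fun n => by
    filter_upwards [hrγ n, h.q_nonneg n] with ω h1 h2
    -- The factor 2 in the rate comes from the chord bound `exp r - 1 ≤ (exp 1 - 1) * r ≤ 2 * r` on
    -- `[0,1]`.
    have h3 := exp_mul_le_one_add (v := 1) (hr0 n ω) (hr1 n ω)
    rw [one_mul] at h3
    have h4 : Real.exp (r n ω) - 1 ≤ 2 * r n ω := by
      have := mul_le_mul_of_nonneg_left (show Real.exp 1 - 1 ≤ 2 by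
        linarith [Real.exp_one_lt_d9]) (hr0 n ω)
      linarith
    have := mul_le_mul_of_nonneg_left h4 h2
    linarith
  -- The discount `e n` depends on the past only. Hence `x` can be exchanged for `q`, then `r * q`
  -- for the conditional probability of `b`, and finally that for `b` itself.
  have hstep : ∀ n < N, ∫ ω, e n ω * (r n ω * l n ω) * x n ω ∂μ ≤ 1 / N := fun n hn => by
    calc ∫ ω, e n ω * (r n ω * l n ω) * x n ω ∂μ
        = ∫ ω, e n ω * (r n ω * l n ω) * q n ω ∂μ := h.integral_mul_x (hQm n) (hQb n)
      _ ≤ ∫ ω, e n ω * (μ[b | H n]) ω ∂μ := by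
          refine integral_mono_ae (h.integrable_mul_q (hQm n) (hQb n))
            (integrable_condExp.bdd_mul ((hem n).mono (h.H_le n) le_rfl).aestronglyMeasurable
              (Filter.Eventually.of_forall (heb n))) ?_
          filter_upwards [hrp n hn, h.q_nonneg n] with ω h1 h2
          have h3 : (r n ω * q n ω) * l n ω ≤ r n ω * q n ω :=
            mul_le_of_le_one_right (mul_nonneg (hr0 n ω) h2) (h.l_le n ω)
          have := mul_le_mul_of_nonneg_left (h3.trans h1) (he0 n ω)
          linarith
      _ = ∫ ω, e n ω * b ω ∂μ :=
          (integral_mul_eq_of_condExp_ae_eq (h.H_le n) (hem n) (heb n) hbint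
            (Filter.EventuallyEq.refl _ _)).symm
      _ = Real.exp (-s) * ∫ ω, Real.exp (observedLoss r x l n ω) * b ω ∂μ := by
          rw [← integral_const_mul]
          congr 1
          ext ω
          rw [← mul_assoc, ← Real.exp_add, neg_add_eq_sub]
      _ ≤ Real.exp (-s) * Real.exp (2 * γ * Λ) :=
          mul_le_mul_of_nonneg_left (h.integral_exp_observedLoss_mul_le hr hr0 hr1
            (by positivity) hrate hb hb0 hb1 hbΛ hn.le) (Real.exp_pos _).le
      _ = 1 / N := by
          rw [← Real.exp_add, hs, show -(2 * γ * Λ + Real.log N) + 2 * γ * Λ = -Real.log N by ring,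
            Real.exp_neg, Real.exp_log (by linarith), one_div]
  have hint : ∀ n, Integrable (fun ω => e n ω * (r n ω * l n ω) * x n ω) μ := fun n =>
    h.integrable_mul_x (hQm n) (hQb n)
  calc ∫ ω, ∑ n ∈ Finset.range N, r n ω * (q n ω * l n ω) ∂μ
      = ∑ n ∈ Finset.range N, ∫ ω, r n ω * l n ω * q n ω ∂μ := by
        rw [← integral_finsetSum _ fun n _ => h.integrable_mul_q (hrl n) (hrlb n)]
        congr 1; ext ω
        exact Finset.sum_congr rfl fun n _ => by ring
    _ = ∑ n ∈ Finset.range N, ∫ ω, r n ω * l n ω * x n ω ∂μ :=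
        Finset.sum_congr rfl fun n _ => (h.integral_mul_x (hrl n) (hrlb n)).symm
    _ = ∫ ω, ∑ n ∈ Finset.range N, r n ω * l n ω * x n ω ∂μ :=
        (integral_finsetSum _ fun n _ => h.integrable_mul_x (hrl n) (hrlb n)).symm
    _ ≤ ∫ ω, (s + 1 + ∑ n ∈ Finset.range N, e n ω * (r n ω * l n ω) * x n ω) ∂μ := by
        refine integral_mono (integrable_finsetSum _ fun n _ =>
          h.integrable_mul_x (hrl n) (hrlb n))
          ((integrable_const _).add (integrable_finsetSum _ fun n _ => hint n)) fun ω => ?_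
        have h1 := sum_range_le_level_add_exp (fun k => r k ω * (x k ω * l k ω))
          (fun k => mul_nonneg (hr0 k ω) (h.xl_nonneg k ω))
          (fun k => mul_le_one₀ (hr1 k ω) (h.xl_nonneg k ω) (h.xl_le k ω)) hs0 N
        refine le_trans (le_of_eq (Finset.sum_congr rfl fun n _ => by ring)) (h1.trans
          (le_of_eq ?_))
        congr 1
        exact Finset.sum_congr rfl fun n _ => by simp only [he, observedLoss]; ring
    _ = s + 1 + ∑ n ∈ Finset.range N, ∫ ω, e n ω * (r n ω * l n ω) * x n ω ∂μ := by
        rw [integral_add (integrable_const _) (integrable_finsetSum _ fun n _ => hint n),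
          integral_finsetSum _ fun n _ => hint n]
        simp
    _ ≤ s + 1 + ∑ n ∈ Finset.range N, (1 / N : ℝ) :=
        add_le_add_right (Finset.sum_le_sum fun n hn => hstep n (Finset.mem_range.1 hn)) _
    _ = 2 * γ * Λ + Real.log N + 2 := by
        rw [Finset.sum_const, Finset.card_range, nsmul_eq_mul, mul_one_div_cancel (by linarith), hs]
        ring

/-! ### Common rounds -/

/-- The value of `M` in the last round before `n` in which `c` is one (zero if there is none). -/
noncomputable def lastValue (c M : ℕ → Ω → ℝ) : ℕ → Ω → ℝ
  | 0 => 0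
  | n + 1 => fun ω => lastValue c M n ω + c n ω * (M n ω - lastValue c M n ω)

/-- If the conditional probability of `b` is at least `γ` whenever `c` is one, then the moments of
the last value at such rounds are controlled by those on the event `b`. -/
theorem integral_exp_lastValue_le {b : Ω → ℝ} {c M : ℕ → Ω → ℝ} (hH : ∀ n, H n ≤ m0)
    (hHmono : Monotone H) (hc : ∀ n, Measurable[H n] (c n)) (hM : ∀ n, Measurable[H n] (M n))
    (hc01 : ∀ n ω, c n ω = 0 ∨ c n ω = 1)
    (hSM : ∀ n ω, lastValue c M n ω ≤ M n ω) {K : ℝ} (hMK : ∀ n ω, M n ω ≤ n * K)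
    (hb : Measurable[m0] b) (hb0 : ∀ ω, 0 ≤ b ω) (hb1 : ∀ ω, b ω ≤ 1) {γ : ℝ} (hγ : 0 < γ)
    {N : ℕ} (hcp : ∀ n < N, ∀ᵐ ω ∂μ, c n ω = 1 → γ ≤ (μ[b | H n]) ω) :
    ∫ ω, Real.exp (lastValue c M N ω) ∂μ ≤ 1 + γ⁻¹ * ∫ ω, Real.exp (M N ω) * b ω ∂μ := by
  have hbint : Integrable b μ :=
    integrable_of_measurable_of_abs_le (m := m0) le_rfl hb (C := 1)
      fun ω => by rw [abs_of_nonneg (hb0 ω)]; exact hb1 ω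
  have hSm' : ∀ n, Measurable[H n] (lastValue c M n) →
      Measurable[H n] (lastValue c M (n + 1)) := fun n hn =>
    hn.add ((hc n).mul ((hM n).sub hn))
  have hSm : ∀ n, Measurable[H n] (lastValue c M n) := fun n => by
    induction n with
    | zero => exact measurable_const
    | succ n ih => exact (hSm' n ih).mono (hHmono n.le_succ) le_rfl
  set E : ℕ → Ω → ℝ := fun n ω => Real.exp (lastValue c M n ω) with hE
  have hE0 : ∀ n ω, 0 ≤ E n ω := fun n ω => (Real.exp_pos _).le
  have hEb : ∀ n ω, |E n ω| ≤ Real.exp (n * K) := fun n ω => by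
    rw [abs_of_nonneg (hE0 n ω)]
    exact Real.exp_le_exp.2 ((hSM n ω).trans (hMK n ω))
  have hEm : ∀ n, Measurable[H n] (E n) := fun n => Real.measurable_exp.comp (hSm n)
  have hEint : ∀ n, Integrable (E n) μ := fun n =>
    integrable_of_measurable_of_abs_le (hH n) (hEm n) (hEb n)
  have hmulb : ∀ f : Ω → ℝ, Integrable f μ → Integrable (fun ω => f ω * b ω) μ := fun f hf =>
    hf.mul_bdd (c := 1) hb.aestronglyMeasurable
      (Filter.Eventually.of_forall fun ω => by
        rw [Real.norm_eq_abs, abs_of_nonneg (hb0 ω)]; exact hb1 ω)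
  -- Telescoping from `E 0 = 1`: the increment `Q` is nonnegative, known at round `n`, and zero
  -- unless `c n = 1`, where `b` has conditional probability at least `γ`. So `∫ Q ≤ γ⁻¹ * ∫ Q * b`.
  have hind : ∀ n ≤ N, ∫ ω, E n ω ∂μ ≤ 1 + γ⁻¹ * ∫ ω, (E n ω - 1) * b ω ∂μ := fun n => by
    induction n with
    | zero => intro _; simp [hE, lastValue]
    | succ n ih =>
      intro hn
      have ih := ih (by omega)
      set Q : Ω → ℝ := fun ω => E (n + 1) ω - E n ω with hQ
      have hQm : Measurable[H n] Q :=
        (Real.measurable_exp.comp (hSm' n (hSm n))).sub (hEm n)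
      have hQ0 : ∀ ω, 0 ≤ Q ω := fun ω => by
        refine sub_nonneg.2 (Real.exp_le_exp.2 ?_)
        have := hSM n ω
        rcases hc01 n ω with h | h <;> simp [lastValue, h, this]
      have hQb : ∀ ω, |Q ω| ≤ Real.exp ((n + 1 : ℕ) * K) := fun ω => by
        rw [abs_of_nonneg (hQ0 ω)]
        have h1 := hEb (n + 1) ω
        rw [abs_of_nonneg (hE0 _ ω)] at h1
        have := hE0 n ω
        simp only [hQ]
        linarith
      have h1 : ∫ ω, Q ω ∂μ ≤ γ⁻¹ * ∫ ω, Q ω * b ω ∂μ := by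
        rw [integral_mul_eq_of_condExp_ae_eq (hH n) hQm hQb hbint (Filter.EventuallyEq.refl _ _),
          ← integral_const_mul]
        refine integral_mono_ae (integrable_of_measurable_of_abs_le (hH n) hQm hQb)
          ((integrable_condExp.bdd_mul (hQm.mono (hH n) le_rfl).aestronglyMeasurable
            (Filter.Eventually.of_forall hQb)).const_mul _) ?_
        filter_upwards [hcp n (by omega)] with ω hω
        rcases hc01 n ω with h | h
        · simp [hQ, hE, lastValue, h]
        · rw [← div_eq_inv_mul, le_div_iff₀ hγ]
          exact mul_le_mul_of_nonneg_left (hω h) (hQ0 ω)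
      have h2 : ∫ ω, Q ω ∂μ = ∫ ω, E (n + 1) ω ∂μ - ∫ ω, E n ω ∂μ :=
        integral_sub (hEint _) (hEint _)
      have h3 : ∫ ω, (E (n + 1) ω - 1) * b ω ∂μ
          = ∫ ω, Q ω * b ω ∂μ + ∫ ω, (E n ω - 1) * b ω ∂μ := by
        rw [← integral_add (hmulb Q ((hEint _).sub (hEint _)))
          (hmulb (fun ω => E n ω - 1) ((hEint n).sub (integrable_const 1)))]
        congr 1; ext ω
        simp only [hQ]; ring
      rw [h3, mul_add]
      linarith
  refine (hind N le_rfl).trans (add_le_add_right (mul_le_mul_of_nonneg_left ?_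
    (inv_nonneg.2 hγ.le)) _)
  refine integral_mono (hmulb (fun ω => E N ω - 1) ((hEint N).sub (integrable_const 1)))
    (hmulb _ (integrable_of_measurable_of_abs_le (hH N) (Real.measurable_exp.comp (hM N))
      (C := Real.exp (N * K)) fun ω => ?_)) fun ω => ?_
  · rw [abs_of_nonneg (Real.exp_pos _).le]
    exact Real.exp_le_exp.2 (hMK N ω)
  · refine mul_le_mul_of_nonneg_right ?_ (hb0 ω)
    have := Real.exp_le_exp.2 (hSM N ω)
    simp only [hE]
    linarith

theorem integral_le_log_of_integral_exp_le {f : Ω → ℝ} (hf : Integrable f μ)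
    (hfe : Integrable (fun ω => Real.exp (f ω)) μ) {A : ℝ} (hA : 0 < A)
    (h : ∫ ω, Real.exp (f ω) ∂μ ≤ A) : ∫ ω, f ω ∂μ ≤ Real.log A := by
  -- Jensen's inequality by hand, through the tangent of `exp` at `log A`.
  have h1 : ∫ ω, (f ω + (1 - Real.log A)) ∂μ ≤ ∫ ω, A⁻¹ * Real.exp (f ω) ∂μ :=
    integral_mono (hf.add (integrable_const _)) (hfe.const_mul _)
      fun ω => by
        have := Real.add_one_le_exp (f ω - Real.log A)
        rw [Real.exp_sub, Real.exp_log hA, div_eq_inv_mul] at this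
        simp only
        linarith
  rw [integral_const_mul, integral_add hf (integrable_const _)] at h1
  simp only [integral_const, probReal_univ, one_smul] at h1
  have h2 : A⁻¹ * ∫ ω, Real.exp (f ω) ∂μ ≤ 1 := by
    rw [← div_eq_inv_mul]; exact (div_le_one hA).2 h
  linarith

/-- Importance weighting at scale `t = sqrt (γ / Λ)`: the second-order part `t ^ 2 / γ` of the
exponential rate costs exactly one over total loss `Λ`, and every remaining error of order one is
multiplied by `1 / t = sqrt (Λ / γ)` at the end. -/
theorem integral_sum_common_le (h : ArmProcess μ H L x l q) {c : ℕ → Ω → ℝ}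
    (hc : ∀ n, Measurable[H n] (c n)) (hc01 : ∀ n ω, c n ω = 0 ∨ c n ω = 1)
    {γ Λ : ℝ} (hγ : 0 < γ) (hγ1 : γ ≤ 1) (hΛ : 0 < Λ) (hγΛ : 1 ≤ γ * Λ) {N : ℕ} {b : Ω → ℝ}
    (hb : Measurable[m0] b) (hb0 : ∀ ω, 0 ≤ b ω) (hb1 : ∀ ω, b ω ≤ 1)
    (hbΛ : ∀ᵐ ω ∂μ, b ω ≠ 0 → ∑ k ∈ Finset.range N, l k ω ≤ Λ)
    (hcp : ∀ n < N, ∀ᵐ ω ∂μ, c n ω = 1 → γ ≤ (μ[b | H n]) ω)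
    (hcq : ∀ n, ∀ᵐ ω ∂μ, c n ω = 1 → γ ≤ q n ω) :
    ∫ ω, ∑ n ∈ Finset.range N, c n ω * l n ω ∂μ
      ≤ Λ + (Real.log (1 / γ) + 3) * Real.sqrt (Λ / γ) := by
  set s : ℝ := Real.sqrt (Λ / γ) with hs
  have hs0 : 0 < s := Real.sqrt_pos.2 (div_pos hΛ hγ)
  have hss : s * s = Λ / γ := Real.mul_self_sqrt (div_pos hΛ hγ).le
  have hsγ : 1 / γ ≤ s := by
    refine Real.le_sqrt_of_sq_le ?_
    rw [div_pow, one_pow, div_le_div_iff₀ (by positivity) hγ]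
    nlinarith
  set t : ℝ := s⁻¹ with ht
  have ht0 : 0 < t := inv_pos.2 hs0
  -- This is where `1 ≤ γ * Λ` enters: it keeps the weights at most one, as the quadratic estimate
  -- for `exp` requires.
  have htγ : t ≤ γ := by
    have := inv_anti₀ (by positivity) hsγ
    simpa using this
  have htt : t ^ 2 / γ * Λ = 1 := by
    rw [ht, inv_pow, pow_two, hss]
    field_simp
  -- In common rounds this is `t / q` almost surely; the maximum with `γ` makes the bound on the
  -- weights hold everywhere.
  set v : ℕ → Ω → ℝ := fun n ω => t * (c n ω / max (q n ω) γ) with hv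
  have hmax : ∀ n ω, 0 < max (q n ω) γ := fun n ω => lt_max_of_lt_right hγ
  have hc0 : ∀ n ω, 0 ≤ c n ω := fun n ω => by rcases hc01 n ω with h | h <;> simp [h]
  have hc1 : ∀ n ω, c n ω ≤ 1 := fun n ω => by rcases hc01 n ω with h | h <;> simp [h]
  have hvm : ∀ n, Measurable[H n] (v n) := fun n =>
    ((hc n).div ((h.q_meas n).max measurable_const)).const_mul t
  have hv0 : ∀ n ω, 0 ≤ v n ω := fun n ω =>
    mul_nonneg ht0.le (div_nonneg (hc0 n ω) (hmax n ω).le)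
  have hvK : ∀ n ω, v n ω ≤ t * (1 / γ) := fun n ω =>
    mul_le_mul_of_nonneg_left (div_le_div₀ zero_le_one (hc1 n ω) hγ (le_max_right _ _)) ht0.le
  have hK1 : t * (1 / γ) ≤ 1 := by
    rw [mul_one_div]; exact (div_le_one hγ).2 htγ
  have hrate : ∀ n, ∀ᵐ ω ∂μ, q n ω * (Real.exp (v n ω) - 1) ≤ t + t ^ 2 / γ := fun n => by
    filter_upwards [hcq n] with ω hω
    rcases hc01 n ω with hz | hz
    · simp only [hv, hz, zero_div, mul_zero, Real.exp_zero, sub_self]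
      positivity
    · have hq := hω hz
      have hq0 : 0 < q n ω := hγ.trans_le hq
      have hvq : v n ω = t / q n ω := by
        simp only [hv, hz, max_eq_left hq, mul_one_div]
      have h1 := Real.abs_exp_sub_one_sub_id_le (x := v n ω)
        (by rw [abs_of_nonneg (hv0 n ω)]; exact (hvK n ω).trans hK1)
      have h2 : Real.exp (v n ω) - 1 ≤ v n ω + v n ω ^ 2 := by linarith [(abs_le.1 h1).2]
      calc q n ω * (Real.exp (v n ω) - 1) ≤ q n ω * (v n ω + v n ω ^ 2) :=
            mul_le_mul_of_nonneg_left h2 hq0.le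
        _ = t + t ^ 2 / q n ω := by rw [hvq]; field_simp
        _ ≤ t + t ^ 2 / γ :=
            add_le_add_right (div_le_div_of_nonneg_left (sq_nonneg t) hγ hq) _
  set M : ℕ → Ω → ℝ := observedLoss v x l with hMdef
  have hMm : ∀ n, Measurable[H n] (M n) := h.measurable_observedLoss hvm
  have hMK : ∀ n ω, M n ω ≤ n * (t * (1 / γ)) := h.observedLoss_le hv0 hvK
  have hM0 : ∀ n ω, 0 ≤ M n ω := h.observedLoss_nonneg hv0
  -- `M` moves only when `c` is one, so since its value at the last such round it has gained at most
  -- one increment.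
  have hS : ∀ n ω, 0 ≤ lastValue c M n ω ∧ lastValue c M n ω ≤ M n ω ∧
      M n ω ≤ lastValue c M n ω + t * (1 / γ) := fun n ω => by
    induction n with
    | zero =>
      have : 0 ≤ t * (1 / γ) := by positivity
      simp [lastValue, hMdef, observedLoss]
      positivity
    | succ n ih =>
      obtain ⟨i1, i2, i3⟩ := ih
      have hstep : M (n + 1) ω = M n ω + v n ω * (x n ω * l n ω) := observedLoss_succ v x l n ω
      have h0 := mul_nonneg (hv0 n ω) (h.xl_nonneg n ω)
      have h1 : v n ω * (x n ω * l n ω) ≤ t * (1 / γ) :=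
        (mul_le_of_le_one_right (hv0 n ω) (h.xl_le n ω)).trans (hvK n ω)
      rcases hc01 n ω with hz | hz
      · have hvz : v n ω = 0 := by simp [hv, hz]
        have hSz : lastValue c M (n + 1) ω = lastValue c M n ω := by simp [lastValue, hz]
        rw [hstep, hvz, hSz, zero_mul, add_zero]
        exact ⟨i1, i2, i3⟩
      · have hSz : lastValue c M (n + 1) ω = M n ω := by simp [lastValue, hz]
        rw [hstep, hSz]
        exact ⟨hM0 n ω, by linarith, by linarith⟩
  have hmom := integral_exp_lastValue_le h.H_le h.H_mono hc hMm hc01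
    (fun n ω => (hS n ω).2.1) hMK hb hb0 hb1 hγ hcp
  have hmom' := h.integral_exp_observedLoss_mul_le hvm hv0 hvK (c := t + t ^ 2 / γ)
    (by positivity) hrate hb hb0 hb1 hbΛ le_rfl
  have hrateΛ : (t + t ^ 2 / γ) * Λ = t * Λ + 1 := by rw [add_mul, htt]
  rw [hrateΛ] at hmom'
  have hSm : Measurable[m0] (lastValue c M N) := by
    suffices ∀ n, Measurable[m0] (lastValue c M n) from this N
    intro n
    induction n with
    | zero => exact measurable_const
    | succ n ih =>
      exact ih.add (((hc n).mono (h.H_le n) le_rfl).mul (((hMm n).mono (h.H_le n) le_rfl).sub ih))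
  have hSint : Integrable (lastValue c M N) μ :=
    integrable_of_measurable_of_abs_le (m := m0) le_rfl hSm (C := N * (t * (1 / γ))) fun ω => by
      rw [abs_of_nonneg (hS N ω).1]; exact (hS N ω).2.1.trans (hMK N ω)
  have hSeint : Integrable (fun ω => Real.exp (lastValue c M N ω)) μ :=
    integrable_of_measurable_of_abs_le (m := m0) le_rfl (Real.measurable_exp.comp hSm)
      (C := Real.exp (N * (t * (1 / γ)))) fun ω => by
      rw [abs_of_nonneg (Real.exp_pos _).le]
      exact Real.exp_le_exp.2 ((hS N ω).2.1.trans (hMK N ω))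
  -- Thanks to `γ ≤ 1`, the additive 1 in `hmom` is absorbed into a factor 2.
  have hbig : (1 : ℝ) ≤ γ⁻¹ * Real.exp (t * Λ + 1) :=
    one_le_mul_of_one_le_of_one_le ((one_le_inv₀ hγ).2 hγ1) (Real.one_le_exp (by positivity))
  have hlog : ∫ ω, lastValue c M N ω ∂μ ≤ Real.log (2 * (γ⁻¹ * Real.exp (t * Λ + 1))) := by
    refine integral_le_log_of_integral_exp_le hSint hSeint (by positivity) (hmom.trans ?_)
    have := mul_le_mul_of_nonneg_left hmom' (inv_nonneg.2 hγ.le)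
    linarith
  rw [Real.log_mul two_ne_zero (by positivity), Real.log_mul (by positivity) (Real.exp_pos _).ne',
    Real.log_exp] at hlog
  have hMint : Integrable (M N) μ :=
    integrable_of_measurable_of_abs_le (h.H_le N) (hMm N) (C := N * (t * (1 / γ))) fun ω => by
      rw [abs_of_nonneg (hM0 N ω)]; exact hMK N ω
  have hMle : ∫ ω, M N ω ∂μ ≤ ∫ ω, lastValue c M N ω ∂μ + t * (1 / γ) := by
    calc ∫ ω, M N ω ∂μ ≤ ∫ ω, (lastValue c M N ω + t * (1 / γ)) ∂μ :=
          integral_mono hMint (hSint.add (integrable_const _)) fun ω => (hS N ω).2.2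
      _ = _ := by rw [integral_add hSint (integrable_const _)]; simp
  have hvl : ∀ n, Measurable[H n ⊔ L] (fun ω => v n ω * l n ω) := fun n =>
    ((hvm n).mono le_sup_left le_rfl).mul ((h.l_meas n).mono le_sup_right le_rfl)
  have hvlb : ∀ n ω, |v n ω * l n ω| ≤ t * (1 / γ) := fun n ω => by
    rw [abs_of_nonneg (mul_nonneg (hv0 n ω) (h.l_nonneg n ω))]
    exact (mul_le_of_le_one_right (hv0 n ω) (h.l_le n ω)).trans (hvK n ω)
  have hMeq : ∫ ω, M N ω ∂μ = t * ∫ ω, ∑ n ∈ Finset.range N, c n ω * l n ω ∂μ := by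
    calc ∫ ω, M N ω ∂μ = ∫ ω, ∑ n ∈ Finset.range N, v n ω * l n ω * x n ω ∂μ := by
          congr 1; ext ω
          exact Finset.sum_congr rfl fun n _ => by ring
      _ = ∑ n ∈ Finset.range N, ∫ ω, v n ω * l n ω * q n ω ∂μ := by
          rw [integral_finsetSum _ fun n _ => h.integrable_mul_x (hvl n) (hvlb n)]
          exact Finset.sum_congr rfl fun n _ => h.integral_mul_x (hvl n) (hvlb n)
      _ = ∫ ω, ∑ n ∈ Finset.range N, v n ω * l n ω * q n ω ∂μ :=
          (integral_finsetSum _ fun n _ => h.integrable_mul_q (hvl n) (hvlb n)).symm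
      _ = ∫ ω, t * ∑ n ∈ Finset.range N, c n ω * l n ω ∂μ := by
          refine integral_congr_ae ?_
          filter_upwards [ae_all_iff.2 hcq] with ω hω
          rw [Finset.mul_sum]
          refine Finset.sum_congr rfl fun n _ => ?_
          rcases hc01 n ω with hz | hz
          · simp [hv, hz]
          · have hq := hω n hz
            have hq0 : 0 < q n ω := hγ.trans_le hq
            simp only [hv, hz, max_eq_left hq]
            field_simp
      _ = _ := integral_const_mul _ _
  have hlog2 : Real.log 2 ≤ 1 := by linarith [Real.log_two_lt_d9]
  have hlogγ : Real.log γ⁻¹ = Real.log (1 / γ) := by rw [one_div]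
  rw [hlogγ] at hlog
  -- The constant 3 collects `log 2 ≤ 1`, the second-order term 1, and the last increment `t / γ ≤
  -- 1`.
  have hfin : t * ∫ ω, ∑ n ∈ Finset.range N, c n ω * l n ω ∂μ
      ≤ t * Λ + (Real.log (1 / γ) + 3) := by linarith
  have := mul_le_mul_of_nonneg_left hfin hs0.le
  have hst : s * t = 1 := mul_inv_cancel₀ hs0.ne'
  rw [← mul_assoc, hst, one_mul, mul_add, ← mul_assoc, hst, one_mul] at this
  linarith

end ArmProcess

/-! ### From the game to a single arm -/

section Horizon

variable {Ω : Type*} {d T : ℕ}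

/-- The player's information before round `n`, for an arbitrary natural number `n`. -/
@[reducible] noncomputable def historyBefore (ℓ : Fin T → Ω → Fin d → ℝ)
    (a : Fin T → Ω → Set (Fin d)) (n : ℕ) : MeasurableSpace Ω :=
  ⨆ s : Fin T, ⨆ _ : (s : ℕ) < n,
    MeasurableSpace.comap (fun ω => (a s ω, (a s ω).indicator (ℓ s ω))) inferInstance

theorem historyBefore_mono (ℓ : Fin T → Ω → Fin d → ℝ) (a : Fin T → Ω → Set (Fin d)) :
    Monotone (historyBefore ℓ a) := fun _ _ hmn =>
  iSup_mono fun _ => iSup_mono' fun hs => ⟨hs.trans_le hmn, le_rfl⟩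

/-- Extension of a process beyond the horizon by zero. -/
noncomputable def extendZero (f : Fin T → Ω → ℝ) (n : ℕ) : Ω → ℝ :=
  if h : n < T then f ⟨n, h⟩ else 0

@[simp] theorem extendZero_coe (f : Fin T → Ω → ℝ) (t : Fin T) : extendZero f t = f t := by
  simp [extendZero]

theorem forall_extendZero {P : ℕ → (Ω → ℝ) → Prop} (f : Fin T → Ω → ℝ)
    (hf : ∀ t : Fin T, P t (f t)) (h0 : ∀ n, P n 0) (n : ℕ) : P n (extendZero f n) := by
  by_cases h : n < T
  · simpa [extendZero, h] using hf ⟨n, h⟩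
  · simpa [extendZero, h] using h0 n

theorem measurableSet_mem_arm {m : MeasurableSpace Ω} {s : Ω → Set (Fin d)}
    (hs : Measurable[m] s) (i : Fin d) : MeasurableSet[m] {ω | i ∈ s ω} :=
  hs (measurableSet_setOfPred.2 (measurable_set_mem i))

theorem measurable_feedback {ℓ : Fin T → Ω → Fin d → ℝ} {a : Fin T → Ω → Set (Fin d)}
    (t : Fin T) (i : Fin d) :
    Measurable[historyBefore ℓ a (t + 1)] fun ω => (a t ω).indicator (ℓ t ω) i := by
  have h1 : Measurable[MeasurableSpace.comap
      (fun ω => (a t ω, (a t ω).indicator (ℓ t ω))) inferInstance]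
      fun ω => (a t ω, (a t ω).indicator (ℓ t ω)) := comap_measurable _
  exact ((measurable_pi_apply i).comp (measurable_snd.comp h1)).mono
    (le_iSup₂_of_le t (Nat.lt_succ_self _) le_rfl) le_rfl

variable [m0 : MeasurableSpace Ω] {ℓ : Fin T → Ω → Fin d → ℝ} {a : Fin T → Ω → Set (Fin d)}

theorem historyBefore_le (hℓ : ∀ t, Measurable (ℓ t)) (ha : ∀ t, Measurable (a t)) (n : ℕ) :
    historyBefore ℓ a n ≤ m0 := by
  refine iSup_le fun s => iSup_le fun _ => Measurable.comap_le ((ha s).prodMk ?_)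
  refine measurable_pi_iff.2 fun j => ?_
  have : (fun ω => (a s ω).indicator (ℓ s ω) j) =
      {ω | j ∈ a s ω}.indicator fun ω => ℓ s ω j := by
    ext ω
    by_cases h : j ∈ a s ω <;> simp [h]
  rw [this]
  exact (measurable_pi_iff.1 (hℓ s) j).indicator (measurableSet_mem_arm (ha s) j)

/-- Nonanticipation concerns the exact played set; the event of playing arm `i` is the finite
disjoint union, over the sets containing `i`, of such events. -/
theorem IsNonanticipating.condExp_mem_arm {μ : Measure Ω} [IsProbabilityMeasure μ]
    (ha : ∀ t, Measurable (a t)) (h : IsNonanticipating μ ℓ a) (t : Fin T) (i : Fin d) :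
    μ⟦{ω | i ∈ a t ω} | history ℓ a t ⊔ lossSigma ℓ⟧ =ᵐ[μ] playProb μ ℓ a t i := by
  classical
  set S : Finset (Set (Fin d)) := Finset.univ.filter fun A => i ∈ A with hS
  have hsum : ({ω | i ∈ a t ω}.indicator fun _ => (1 : ℝ)) =
      ∑ A ∈ S, {ω | a t ω = A}.indicator fun _ => (1 : ℝ) := by
    ext ω
    rw [Finset.sum_apply]
    simp only [Set.indicator_apply, Set.mem_ofPred_eq, Finset.sum_ite_eq]
    simp [hS]
  have hint : ∀ A ∈ S, Integrable ({ω | a t ω = A}.indicator fun _ => (1 : ℝ)) μ := fun A _ =>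
    (integrable_const 1).indicator (ha t (measurableSet_singleton A))
  unfold playProb
  rw [hsum]
  filter_upwards [condExp_finsetSum hint (history ℓ a t ⊔ lossSigma ℓ),
    condExp_finsetSum hint (history ℓ a t), ae_all_iff.2 (h t)] with ω h1 h2 h3
  rw [h1, h2, Finset.sum_apply, Finset.sum_apply]
  exact Finset.sum_congr rfl fun A _ => h3 A

/-- The product `x * l` is coordinate `i` of the feedback, hence known one round later although `l`
itself is not. Beyond the horizon all processes vanish and the conditions are trivial. -/
theorem armProcess {μ : Measure Ω} [IsProbabilityMeasure μ]
    (hℓ_meas : ∀ t, Measurable (ℓ t)) (hℓ_mem : ∀ t ω i, ℓ t ω i ∈ Set.Icc (0 : ℝ) 1)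
    (ha_meas : ∀ t, Measurable (a t)) (ha : IsNonanticipating μ ℓ a) (i : Fin d) :
    ArmProcess μ (historyBefore ℓ a) (lossSigma ℓ)
      (extendZero fun t => {ω | i ∈ a t ω}.indicator fun _ => 1)
      (extendZero fun t ω => ℓ t ω i) (extendZero fun t => playProb μ ℓ a t i) where
  H_le := historyBefore_le hℓ_meas ha_meas
  H_mono := historyBefore_mono ℓ a
  L_le := Measurable.comap_le (measurable_pi_iff.2 hℓ_meas)
  x_meas := forall_extendZero (P := fun _ f => Measurable f) _
    (fun t => measurable_const.indicator (measurableSet_mem_arm (ha_meas t) i))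
    fun _ => measurable_const
  x_nonneg := forall_extendZero (P := fun _ f => ∀ ω, 0 ≤ f ω) _
    (fun t ω => Set.indicator_nonneg (fun _ _ => zero_le_one) ω) fun _ _ => le_rfl
  x_le := forall_extendZero (P := fun _ f => ∀ ω, f ω ≤ 1) _
    (fun t ω => Set.indicator_le_self' (fun _ _ => zero_le_one) ω) fun _ _ => zero_le_one
  l_meas := forall_extendZero (P := fun _ f => Measurable[lossSigma ℓ] f) _
    (fun t => by
      have h1 : Measurable[lossSigma ℓ] fun ω t => ℓ t ω := comap_measurable _
      exact (measurable_pi_apply i).comp ((measurable_pi_apply t).comp h1))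
    fun _ => measurable_const
  l_nonneg := forall_extendZero (P := fun _ f => ∀ ω, 0 ≤ f ω) _
    (fun t ω => (hℓ_mem t ω i).1) fun _ _ => le_rfl
  l_le := forall_extendZero (P := fun _ f => ∀ ω, f ω ≤ 1) _
    (fun t ω => (hℓ_mem t ω i).2) fun _ _ => zero_le_one
  xl_meas n := by
    by_cases h : n < T
    · convert measurable_feedback (ℓ := ℓ) (a := a) ⟨n, h⟩ i using 2 with ω
      by_cases hi : i ∈ a ⟨n, h⟩ ω <;> simp [extendZero, h, hi]
    · simp [extendZero, h]
  q_meas := forall_extendZero (P := fun n f => Measurable[historyBefore ℓ a n] f) _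
    (fun t => stronglyMeasurable_condExp.measurable) fun _ => measurable_const
  q_nonneg := forall_extendZero (P := fun _ f => ∀ᵐ ω ∂μ, 0 ≤ f ω) _
    (fun t => condExp_nonneg (Filter.Eventually.of_forall fun ω =>
      Set.indicator_nonneg (fun _ _ => zero_le_one) ω))
    fun _ => Filter.Eventually.of_forall fun _ => le_rfl
  condExp_x n := by
    by_cases h : n < T
    · simp only [extendZero, h, dite_true]
      exact ha.condExp_mem_arm ha_meas ⟨n, h⟩ i
    · simp only [extendZero, h, dite_false]
      rw [condExp_zero]

theorem sum_loss_le_totalLoss {l : Fin T → Fin d → ℝ} (hl : ∀ t j, 0 ≤ l t j) {A : Set (Fin d)}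
    {i : Fin d} (hi : i ∈ A) : ∑ t, l t i ≤ totalLoss l A :=
  Finset.sum_le_sum fun t _ => by
    have := Finset.single_le_sum (f := fun j => A.indicator (l t) j)
      (fun j _ => Set.indicator_nonneg (fun j _ => hl t j) j) (Finset.mem_univ i)
    simpa [hi] using this

end Horizon
end BayesianGame

/-! ### The theorem -/

theorem mainTheorem9 {Ω : Type*} [MeasurableSpace Ω] (μ : Measure Ω) [IsProbabilityMeasure μ]
    (d T : ℕ)
    -- random loss sequence, with an arbitrary law on `[0,1]`-valued sequences
    (ℓ : Fin T → Ω → Fin d → ℝ)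
    (hℓ_meas : ∀ t, Measurable (ℓ t))
    (hℓ_mem : ∀ t ω i, ℓ t ω i ∈ Set.Icc (0 : ℝ) 1)
    -- the sets of arms played by the player
    (a : Fin T → Ω → Set (Fin d))
    (ha_meas : ∀ t, Measurable (a t))
    (ha : BayesianGame.IsNonanticipating μ ℓ a)
    -- the actions, one of which always has total loss at most `Lstar`
    (𝒜 : Set (Set (Fin d)))
    (Lstar : ℝ) (hLstar_pos : 0 < Lstar)
    (hLstar : ∀ᵐ ω ∂μ, ∃ A ∈ 𝒜, BayesianGame.totalLoss (fun t => ℓ t ω) A ≤ Lstar)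
    -- the optimal set: each of its arms belongs to some optimal action
    -- (an optimal action with ties broken in any way, or all the arms of optimal actions)
    (astar : Ω → Set (Fin d))
    (hastar_meas : Measurable astar)
    (hastar : ∀ᵐ ω ∂μ, ∀ i ∈ astar ω, ∃ A : Set (Fin d),
      BayesianGame.IsOptimalAction 𝒜 (fun t => ℓ t ω) A ∧ i ∈ A)
    -- the rare arms of each round, determined by the history; the other arms are common
    (R : Fin T → Ω → Set (Fin d))
    (hR_meas : ∀ t, Measurable[BayesianGame.history ℓ a t] (R t))
    (γ₁ γ₂ : ℝ) (hγ₁ : 1 / Lstar ≤ γ₁) (hγ₁₂ : γ₁ ≤ γ₂)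
    (hcommon : ∀ᵐ ω ∂μ, ∀ t i, i ∉ R t ω →
      γ₁ ≤ BayesianGame.playProb μ ℓ a t i ω ∧ γ₁ ≤ BayesianGame.optProb μ ℓ a astar t i ω)
    (hrare : ∀ᵐ ω ∂μ, ∀ t i, i ∈ R t ω →
      BayesianGame.playProb μ ℓ a t i ω ≤ BayesianGame.optProb μ ℓ a astar t i ω ∧
        BayesianGame.optProb μ ℓ a astar t i ω ≤ γ₂)
    (i : Fin d) :
    (∫ ω, ∑ t ∈ BayesianGame.rareRounds R i ω, BayesianGame.playProb μ ℓ a t i ω * ℓ t ω i ∂μ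
        ≤ 2 * γ₂ * Lstar + 8 * Real.log T + 4) ∧
      (γ₁ ≤ 1 →
        ∫ ω, ∑ t ∈ BayesianGame.commonRounds R i ω, ℓ t ω i ∂μ
          ≤ Lstar + 2 * (Real.log (1 / γ₁) + 10) * Real.sqrt (Lstar / γ₁)) := by
  open BayesianGame in
  classical
  have hγ : 0 < γ₁ := (one_div_pos.2 hLstar_pos).trans_le hγ₁
  have hγΛ : 1 ≤ γ₁ * Lstar := (div_le_iff₀ hLstar_pos).1 hγ₁
  have hP := armProcess hℓ_meas hℓ_mem ha_meas ha i
  set b : Ω → ℝ := {ω | i ∈ astar ω}.indicator fun _ => 1 with hbdef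
  have hb : Measurable b := measurable_const.indicator (measurableSet_mem_arm hastar_meas i)
  have hb0 : ∀ ω, 0 ≤ b ω := fun ω => Set.indicator_nonneg (fun _ _ => zero_le_one) ω
  have hb1 : ∀ ω, b ω ≤ 1 := fun ω => Set.indicator_le_self' (fun _ _ => zero_le_one) ω
  have hbΛ : ∀ᵐ ω ∂μ, b ω ≠ 0 →
      ∑ k ∈ Finset.range T, extendZero (fun t ω => ℓ t ω i) k ω ≤ Lstar := by
    filter_upwards [hastar, hLstar] with ω h1 h2 hbω
    have hiω : ω ∈ {ω | i ∈ astar ω} := Set.mem_of_indicator_ne_zero hbω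
    obtain ⟨A, hA, hiA⟩ := h1 i hiω
    obtain ⟨B, hB, hBL⟩ := h2
    rw [Finset.sum_range]
    simp only [extendZero_coe]
    exact (sum_loss_le_totalLoss (l := fun t => ℓ t ω) (fun t j => (hℓ_mem t ω j).1) hiA).trans
      ((hA.2 B hB).trans hBL)
  have hRset : ∀ t, MeasurableSet[history ℓ a t] {ω | i ∈ R t ω} := fun t =>
    measurableSet_mem_arm (hR_meas t) i
  constructor
  · set r : ℕ → Ω → ℝ := extendZero fun t => {ω | i ∈ R t ω}.indicator fun _ => 1 with hr
    have hrare' : ∀ n, ∀ᵐ ω ∂μ, r n ω * extendZero (fun t => playProb μ ℓ a t i) n ω ≤ γ₂ := by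
      intro n
      by_cases hn : n < T
      · filter_upwards [hrare] with ω h
        by_cases hi : i ∈ R ⟨n, hn⟩ ω
        · simpa [hr, extendZero, hn, hi] using (h ⟨n, hn⟩ i hi).1.trans (h ⟨n, hn⟩ i hi).2
        · simpa [hr, extendZero, hn, hi] using hγ.le.trans hγ₁₂
      · simpa [hr, extendZero, hn] using hγ.le.trans hγ₁₂
    have key := hP.integral_sum_rare_le (r := r) (γ := γ₂) (Λ := Lstar) (N := T) (b := b)
      (forall_extendZero (P := fun n f => Measurable[historyBefore ℓ a n] f) _
        (fun t => measurable_const.indicator (hRset t)) fun _ => measurable_const)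
      (forall_extendZero (P := fun _ f => ∀ ω, 0 ≤ f ω) _
        (fun t ω => Set.indicator_nonneg (fun _ _ => zero_le_one) ω) fun _ _ => le_rfl)
      (forall_extendZero (P := fun _ f => ∀ ω, f ω ≤ 1) _
        (fun t ω => Set.indicator_le_self' (fun _ _ => zero_le_one) ω) fun _ _ => zero_le_one)
      (hγ.le.trans hγ₁₂) hLstar_pos.le hb hb0 hb1 hbΛ (fun n hn => by
        have hnn : ∀ᵐ ω ∂μ, 0 ≤ optProb μ ℓ a astar ⟨n, hn⟩ i ω :=
          condExp_nonneg (Filter.Eventually.of_forall hb0)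
        filter_upwards [hrare, hnn] with ω h h0
        change _ ≤ optProb μ ℓ a astar ⟨n, hn⟩ i ω
        by_cases hi : i ∈ R ⟨n, hn⟩ ω
        · simpa [hr, extendZero, hn, hi] using (h ⟨n, hn⟩ i hi).1
        · simpa [hr, extendZero, hn, hi] using h0) hrare'
    -- The argument gives `log T + 2`, which is stronger than the claimed `8 * log T + 4`.
    have hlog := Real.log_natCast_nonneg T
    refine le_trans (le_of_eq ?_) (key.trans (by linarith))
    congr 1; ext ω
    rw [Finset.sum_range, rareRounds, Finset.sum_filter]
    refine Finset.sum_congr rfl fun t _ => ?_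
    simp only [hr, extendZero_coe]
    by_cases hi : i ∈ R t ω <;> simp [hi]
  · intro hγ1
    set c : ℕ → Ω → ℝ := extendZero fun t => {ω | i ∉ R t ω}.indicator fun _ => 1 with hc
    have hc_not : ∀ t ω, c (t : Fin T) ω = 1 → i ∉ R t ω := fun t ω h hi => by
      simp [hc, hi] at h
    have key := hP.integral_sum_common_le (c := c) (γ := γ₁) (Λ := Lstar) (N := T) (b := b)
      (forall_extendZero (P := fun n f => Measurable[historyBefore ℓ a n] f) _
        (fun t => measurable_const.indicator (hRset t).compl) fun _ => measurable_const)
      (forall_extendZero (P := fun _ f => ∀ ω, f ω = 0 ∨ f ω = 1) _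
        (fun t ω => by by_cases hi : i ∈ R t ω <;> simp [hi]) fun _ _ => Or.inl rfl)
      hγ hγ1 hLstar_pos hγΛ hb hb0 hb1 hbΛ
      (fun n hn => by
        filter_upwards [hcommon] with ω h hω
        exact (h ⟨n, hn⟩ i (hc_not ⟨n, hn⟩ ω hω)).2)
      (fun n => by
        by_cases hn : n < T
        · filter_upwards [hcommon] with ω h hω
          simpa [extendZero, hn] using (h ⟨n, hn⟩ i (hc_not ⟨n, hn⟩ ω hω)).1
        · simp [hc, extendZero, hn])
    have hlog : 0 ≤ Real.log (1 / γ₁) := Real.log_nonneg ((one_le_div hγ).2 hγ1)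
    -- Here too the constant obtained, `log (1 / γ₁) + 3`, is smaller than the one claimed.
    have hs := mul_le_mul_of_nonneg_right
      (show Real.log (1 / γ₁) + 3 ≤ 2 * (Real.log (1 / γ₁) + 10) by linarith)
      (Real.sqrt_nonneg (Lstar / γ₁))
    refine le_trans (le_of_eq ?_) (key.trans (by linarith))
    congr 1; ext ω
    rw [Finset.sum_range, commonRounds, Finset.sum_filter]
    refine Finset.sum_congr rfl fun t _ => ?_
    simp only [hc, extendZero_coe]
    by_cases hi : i ∈ R t ω <;> simp [hi]
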